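/- For $\ell=1,\dots,p$ let $(\mathbb{E}_\ell,\circ)$ be a finite-dimensional simple Euclidean Jordan algebra with identity $e_\ell$ and cone of squares $\mathcal{K}_\ell=\{y\circ y: y\in\mathbb{E}_\ell\}$. Put $\mathbb{E}=\mathbb{E}_1\times\dots\times\mathbb{E}_p$, $\mathcal{K}=\mathcal{K}_1\times\dots\times\mathcal{K}_p$, $e=(e_1,\dots,e_p)$. A spectral decomposition of $y\in\mathbb{E}_\ell$ is $y=\sum_i\lambda_i c_i$ with $\lambda_i\in\mathbb{R}$ and $(c_i)$ a Jordan frame (pairwise orthogonal primitive idempotents with $\sum_i c_i=e_\ell$); the $\lambda_i$ are the eigenvalues of $y$ and $\mathrm{trace}(y)=\sum_i\lambda_i$. Use the inner products $\langle x_\ell,y_\ell\rangle=\mathrm{trace}(x_\ell\circ y_\ell)$ on $\mathbb{E}_\ell$ and $\langle x,y\rangle=\sum_{\ell=1}^p\langle x_\ell,y_\ell\rangle$ on $\mathbb{E}$; let $\mathcal{P}_{\mathcal{K}}$ be the orthogonal (nearest-point) projection onto $\mathcal{K}$ for the latter, and let $\|x\|_\infty$ be the largest absolute value of an eigenvalue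 of a block of $x$. Let $\mathcal{A}:\mathbb{E}\to\mathbb{R}^m$ be linear with adjoint $\mathcal{A}^*$, and call $x\in\mathbb{E}$ feasible for $\mathrm{P}_{S_\infty}(\mathcal{A})$ if $x\in\operatorname{int}\mathcal{K}$, $\mathcal{A}(x)=0$ and $\|x\|_\infty\le 1$. Let $v\in\operatorname{range}\mathcal{A}^*$ have blocks with spectral decompositions $v_\ell=\sum_{i=1}^{r_\ell}\lambda(v_\ell)_i\,c(v_\ell)_i$, $\ell=1,\dots,p$. For $\ell\in\{1,\dots,p\}$, $i\in\{1,\dots,r_\ell\}$ and $\alpha\in\mathbb{R}$ let, with $[t]^+=\max\{t,0\}$, $$q_{\ell,i}(\alpha)=\bigl[1-\alpha\lambda(v_\ell)_i\bigr]^+ +\sum_{k\ne i}\bigl[-\alpha\lambda(v_\ell)_k\bigr]^+ +\sum_{j\ne\ell}\sum_{k=1}^{r_j}\bigl[-\alpha\lambda(v_j)_k\bigr]^+ .$$ Then for all $\ell\in\{1,\dots,p\}$ and $i\in\{1,\dots,r_\ell\}$ the minimum of $q_{\ell,i}$ over $\mathbb{R}$ is attained, every feasible $x$ of $\mathrm{P}_{S_\infty}(\mathcal{A})$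 satisfies $$\langle c(v_\ell)_i,x_\ell\rangle\le\min_{\alpha\in\mathbb{R}}q_{\ell,i}(\alpha),$$ and $$\min_{\alpha\in\mathbb{R}}q_{\ell,i}(\alpha)=\begin{cases}\min\Bigl\{1,\Bigl\langle e,\mathcal{P}_{\mathcal{K}}\Bigl(-\tfrac{1}{\lambda(v_\ell)_i}v\Bigr)\Bigr\rangle\Bigr\}&\text{if }\lambda(v_\ell)_i\ne0,\\[1ex]1&\text{if }\lambda(v_\ell)_i=0.\end{cases}$$ -/

import Mathlib

/-- A Euclidean Jordan algebra: a real inner product space with a commutative bilinear product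
with identity that satisfies the Jordan identity and for which the inner product is associative.
(Finite dimensionality is a separate hypothesis `[FiniteDimensional ℝ E]`.)  The inner product of
the ambient space is any associative one; the trace inner product is `EJA.trInner` below. -/
class EuclideanJordanAlgebra (E : Type*) [NormedAddCommGroup E] [InnerProductSpace ℝ E] where
  /-- the Jordan product -/
  jmul : E →ₗ[ℝ] E →ₗ[ℝ] E
  /-- the identity element -/
  unit : E
  unit_jmul : ∀ x, jmul unit x = x
  jmul_comm : ∀ x y, jmul x y = jmul y x
  jordan : ∀ x y, jmul x (jmul (jmul x x) y) = jmul (jmul x x) (jmul x y)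
  inner_jmul : ∀ x y z, inner ℝ (jmul x y) z = inner ℝ y (jmul x z)

namespace EJA

open EuclideanJordanAlgebra

section Single

variable {E : Type*} [NormedAddCommGroup E] [InnerProductSpace ℝ E] [EuclideanJordanAlgebra E]

/-- Idempotents. -/
def IsIdem (c : E) : Prop := jmul c c = c

/-- A primitive idempotent: a nonzero idempotent that is not a sum of two nonzero idempotents. -/
def IsPrimitive (c : E) : Prop :=
  c ≠ 0 ∧ IsIdem c ∧ ¬ ∃ a b : E, a ≠ 0 ∧ b ≠ 0 ∧ IsIdem a ∧ IsIdem b ∧ c = a + b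

/-- A Jordan frame: pairwise orthogonal primitive idempotents with sum the identity.  The number
`k` of its elements is not prescribed: it is the rank of the algebra for every Jordan frame. -/
structure IsJordanFrame {k : ℕ} (c : Fin k → E) : Prop where
  primitive : ∀ i, IsPrimitive (c i)
  orthogonal : ∀ i j, i ≠ j → jmul (c i) (c j) = 0
  sum_eq : ∑ i, c i = unit

/-- `x = ∑ i, lam i • c i` is a spectral decomposition of `x`. -/
structure IsSpectralDecomposition {k : ℕ} (x : E) (lam : Fin k → ℝ) (c : Fin k → E) : Prop where
  frame : IsJordanFrame c
  eq_sum : x = ∑ i, lam i • c i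

/-- `t` is an eigenvalue of `x`. -/
def IsEigenvalue (x : E) (t : ℝ) : Prop :=
  ∃ (k : ℕ) (lam : Fin k → ℝ) (c : Fin k → E),
    IsSpectralDecomposition x lam c ∧ ∃ i, lam i = t

/-- `t` is the sum of the eigenvalues, with multiplicities, in some spectral decomposition
of `x`. -/
def IsTrace (x : E) (t : ℝ) : Prop :=
  ∃ (k : ℕ) (lam : Fin k → ℝ) (c : Fin k → E),
    IsSpectralDecomposition x lam c ∧ t = ∑ i, lam i

/-- The trace of `x`: the sum of its eigenvalues, with multiplicities. -/
noncomputable def trace (x : E) : ℝ := Classical.epsilon (IsTrace x)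

/-- The trace inner product `⟨x, y⟩ = trace (x ∘ y)`. -/
noncomputable def trInner (x y : E) : ℝ := trace (jmul x y)

variable (E) in
/-- The symmetric cone of the algebra: the set of squares. -/
def cone : Set E := {x | ∃ y : E, x = jmul y y}

variable (E) in
/-- A simple Euclidean Jordan algebra: a nonzero one that is not a product of two nonzero ones,
that is, not the direct sum of two nonzero ideals. -/
def IsSimpleAlgebra : Prop :=
  Nontrivial E ∧ ∀ I J : Submodule ℝ E,
    (∀ x ∈ I, ∀ y : E, jmul x y ∈ I) → (∀ x ∈ J, ∀ y : E, jmul x y ∈ J) →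
    IsCompl I J → I = ⊥ ∨ J = ⊥

end Single

section Product

variable {p : ℕ} {E : Fin p → Type*} [∀ l, NormedAddCommGroup (E l)]
  [∀ l, InnerProductSpace ℝ (E l)] [∀ l, EuclideanJordanAlgebra (E l)]

/-- The inner product `⟨x, y⟩ = ∑ l, trace (x l ∘ y l)` of the product algebra. -/
noncomputable def prodInner (x y : ∀ l, E l) : ℝ := ∑ l, trInner (x l) (y l)

/-- The norm `‖x‖_J = √⟨x, x⟩`. -/
noncomputable def normJ (x : ∀ l, E l) : ℝ := Real.sqrt (prodInner x x)

variable (E) in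
/-- The identity element `e = (e_1, …, e_p)`. -/
def prodUnit : ∀ l, E l := fun _ => unit

variable (E) in
/-- The cone `K = K_1 × ⋯ × K_p`. -/
def prodCone : Set (∀ l, E l) := {x | ∀ l, x l ∈ cone (E l)}

/-- `y` is a nearest point to `x` in `K`, in the norm `‖·‖_J`. -/
def IsNearestInCone (x y : ∀ l, E l) : Prop :=
  y ∈ prodCone E ∧ ∀ z ∈ prodCone E, normJ (x - y) ≤ normJ (x - z)

/-- The projection onto `K`. -/
noncomputable def projCone (x : ∀ l, E l) : ∀ l, E l := Classical.epsilon (IsNearestInCone x)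

/-- `‖x‖_∞`: the largest absolute value of an eigenvalue of (a block of) `x`. -/
noncomputable def normInf (x : ∀ l, E l) : ℝ :=
  sSup {s : ℝ | ∃ l t, IsEigenvalue (x l) t ∧ s = |t|}

/-- The feasible region: `x ∈ int K`, `A x = 0`, `‖x‖_∞ ≤ 1`. -/
def feasible {m : ℕ} (A : (∀ l, E l) →ₗ[ℝ] (Fin m → ℝ)) : Set (∀ l, E l) :=
  {x | x ∈ interior (prodCone E) ∧ A x = 0 ∧ normInf x ≤ 1}

/-- The range of the adjoint `A*` of `A`, for the dot product on `ℝ^m` and the trace inner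
product: `v = A* w` means that `⟨A x, w⟩ = ⟨x, v⟩` for all `x`. -/
def rangeAdjoint {m : ℕ} (A : (∀ l, E l) →ₗ[ℝ] (Fin m → ℝ)) : Set (∀ l, E l) :=
  {v | ∃ w : Fin m → ℝ, ∀ x, A x ⬝ᵥ w = prodInner x v}

end Product

/-- The function `q_{l,i}` of the eigenvalues `lam j k` (`k`-th eigenvalue of the `j`-th block);
`max t 0` is the positive part of `t`. -/
noncomputable def q {p : ℕ} {r : Fin p → ℕ} (lam : ∀ l, Fin (r l) → ℝ) (l : Fin p)
    (i : Fin (r l)) (α : ℝ) : ℝ :=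
  max (1 - α * lam l i) 0 + ∑ k ∈ Finset.univ.erase i, max (-α * lam l k) 0
    + ∑ j ∈ Finset.univ.erase l, ∑ k, max (-α * lam j k) 0

end EJA

/-! For feasible `x` put t(j,k) = ⟨c(v_j)_k, x_j⟩. These numbers lie in [0,1]: they are nonnegative
since idempotents pair nonnegatively with squares, and at most 1 since the eigenvalues of `x` are.
As A x = 0 and v = A* w, also ∑ λ(v_j)_k t(j,k) = 0. Subtracting α times this sum from t(l,i) and
using s t ≤ [s]⁺ for t ∈ [0,1] gives the bound (`le_q`). For λ = λ(v_l)_i ≠ 0 put s = αλ and let S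
be the value of `q` at s = 1. Then `q` is at least 1 for s ≤ 0, equals (1 - s) + s S on [0,1], and
equals s S ≥ S for s ≥ 1, so its minimum is min{1, S} (`isLeast_q`). The projection onto the cone
replaces eigenvalues by their positive parts, which identifies S with the inner product in the
claim. The rest is Jordan theory: the spectral theorem (`exists_isSpectralDecomposition`), and the
equality of the norms of all primitive idempotents of a simple algebra, by which the trace form is a
multiple of the given inner product (`IsSimpleAlgebra.exists_isTraceScale`). -/

namespace EJA

open EuclideanJordanAlgebra Polynomial

/-! ### Idempotents, power associativity and the spectral theorem. -/

section Algebra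

variable {E : Type*} [NormedAddCommGroup E] [InnerProductSpace ℝ E] [EuclideanJordanAlgebra E]

theorem inner_jmul_right (x y z : E) : inner ℝ (jmul y x) z = inner ℝ y (jmul x z) := by
  rw [jmul_comm, inner_jmul]

theorem jmul_unit (x : E) : jmul x unit = x := by rw [jmul_comm, unit_jmul]

/-- The full linearization of the Jordan identity. -/
theorem jordan_linearized (x y z w : E) :
    jmul x (jmul (jmul y z) w) + jmul y (jmul (jmul z x) w) + jmul z (jmul (jmul x y) w) =
      jmul (jmul y z) (jmul x w) + jmul (jmul z x) (jmul y w) + jmul (jmul x y) (jmul z w) := by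
  have h1 := jordan (x + y + z) w
  have h2 := jordan (x + y) w
  have h3 := jordan (y + z) w
  have h4 := jordan (x + z) w
  have h5 := jordan x w
  have h6 := jordan y w
  have h7 := jordan z w
  simp only [map_add, LinearMap.add_apply, jmul_comm y x, jmul_comm z y, jmul_comm x z]
    at h1 h2 h3 h4 ⊢
  linear_combination (norm := module) (1 / 2 : ℝ) • (h1 - h2 - h3 - h4 + h5 + h6 + h7)

/-- Multiplication by a triple product. -/
theorem jmul_triple (x y w z : E) :
    jmul (jmul (jmul x y) w) z =
      jmul (jmul x w) (jmul y z) + jmul (jmul y w) (jmul x z) + jmul (jmul x y) (jmul w z)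
        - jmul x (jmul w (jmul y z)) - jmul y (jmul w (jmul x z)) := by
  have h := jordan_linearized x y z w
  rw [jmul_comm (jmul y z) w, jmul_comm (jmul z x) w, jmul_comm z (jmul (jmul x y) w),
    jmul_comm z x, jmul_comm (jmul y z) (jmul x w), jmul_comm (jmul x z) (jmul y w),
    jmul_comm z w] at h
  rw [← sub_eq_zero] at h ⊢
  rw [← h]
  abel

/-- The cubic equation of an idempotent, giving its Peirce decomposition. -/
theorem IsIdem.peirce {c : E} (hc : IsIdem c) (x : E) :
    (2 : ℝ) • jmul c (jmul c (jmul c x)) = (3 : ℝ) • jmul c (jmul c x) - jmul c x := by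
  have h := jmul_triple c c c x
  unfold IsIdem at hc
  simp only [hc] at h
  linear_combination (norm := module) h

/-- By the cubic equation, multiplication by `c` can only have eigenvalues t = 0, 1/2, 1, and each
satisfies t = t² + 4(t - t²)². The sum of squares yields both positivity and the case of equality.
-/
theorem IsIdem.inner_jmul_self {c : E} (hc : IsIdem c) (x : E) :
    inner ℝ (jmul c x) x =
      ‖jmul c x‖ ^ 2 + 4 * ‖jmul c x - jmul c (jmul c x)‖ ^ 2 := by
  have h := hc.peirce x
  have h1 := congrArg (fun y => inner ℝ x y) h
  have h2 := congrArg (fun y => inner ℝ (jmul c x) y) h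
  simp only [inner_sub_right, inner_smul_right] at h1 h2
  simp only [← inner_jmul] at h1 h2
  rw [@norm_sub_sq_real]
  simp only [← real_inner_self_eq_norm_sq]
  have h3 : inner ℝ (jmul c (jmul c x)) x = inner ℝ (jmul c x) (jmul c x) := inner_jmul _ _ _
  have h4 : inner ℝ (jmul c (jmul c (jmul c x))) x = inner ℝ (jmul c (jmul c x)) (jmul c x) :=
    inner_jmul _ _ _
  have h5 : inner ℝ (jmul c (jmul c (jmul c (jmul c x)))) x =
    inner ℝ (jmul c (jmul c x)) (jmul c (jmul c x)) := by rw [inner_jmul, inner_jmul]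
  have h6 : inner ℝ (jmul c (jmul c (jmul c x))) (jmul c x) =
    inner ℝ (jmul c (jmul c x)) (jmul c (jmul c x)) := inner_jmul _ _ _
  have h7 := real_inner_comm (jmul c x) (jmul c (jmul c x))
  linarith

theorem IsIdem.inner_jmul_nonneg {c : E} (hc : IsIdem c) (x : E) : 0 ≤ inner ℝ (jmul c x) x := by
  rw [hc.inner_jmul_self]; positivity

theorem IsIdem.jmul_eq_zero_of_inner {c x : E} (hc : IsIdem c) (h : inner ℝ (jmul c x) x = 0) :
    jmul c x = 0 := by
  rw [hc.inner_jmul_self] at h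
  have h1 := sq_nonneg ‖jmul c x‖
  have h2 := sq_nonneg ‖jmul c x - jmul c (jmul c x)‖
  exact norm_eq_zero.1 (pow_eq_zero_iff two_ne_zero |>.1 (by linarith : ‖jmul c x‖ ^ 2 = 0))

theorem IsIdem.inner_eq {c d : E} (hd : IsIdem d) : inner ℝ c d = inner ℝ (jmul c d) d := by
  rw [inner_jmul_right, hd]

theorem IsIdem.inner_nonneg {c d : E} (hc : IsIdem c) (hd : IsIdem d) : 0 ≤ inner ℝ c d := by
  rw [hd.inner_eq]; exact hc.inner_jmul_nonneg d

theorem IsIdem.jmul_eq_zero {c d : E} (hc : IsIdem c) (hd : IsIdem d) (h : inner ℝ c d = 0) :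
    jmul c d = 0 :=
  hc.jmul_eq_zero_of_inner (by rw [← hd.inner_eq, h])

theorem IsIdem.inner_eq_zero {c d : E} (hd : IsIdem d) (h : jmul c d = 0) : inner ℝ c d = 0 := by
  rw [hd.inner_eq, h, inner_zero_left]

theorem IsIdem.unit_sub {c : E} (hc : IsIdem c) : IsIdem (unit - c) := by
  unfold IsIdem at *
  simp [hc, unit_jmul, jmul_unit]

theorem IsIdem.inner_unit {c : E} (hc : IsIdem c) : inner ℝ c unit = ‖c‖ ^ 2 := by
  rw [real_inner_comm, hc.inner_eq, unit_jmul, real_inner_self_eq_norm_sq]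

theorem jmul_triple_end (x y w : E) :
    (jmul (jmul (jmul x y) w) : Module.End ℝ E) =
      jmul (jmul x w) * jmul y + jmul (jmul y w) * jmul x + jmul (jmul x y) * jmul w
        - jmul x * jmul w * jmul y - jmul y * jmul w * jmul x :=
  LinearMap.ext fun z => jmul_triple x y w z

/-- Multiplications by powers of `x` commute with multiplication by `x`. -/
theorem commute_jmul_pow (x : E) (n : ℕ) :
    Commute (jmul (((jmul x : Module.End ℝ E) ^ n) unit) : Module.End ℝ E) (jmul x) := by
  have h2 : Commute (jmul (jmul x x) : Module.End ℝ E) (jmul x) :=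
    LinearMap.ext fun z => (jordan x z).symm
  induction n using Nat.twoStepInduction with
  | zero =>
    have : (jmul (unit : E) : Module.End ℝ E) = 1 := LinearMap.ext fun z => unit_jmul z
    simp [this]
  | one => simp [jmul_unit]
  | more n h0 h1 =>
    have e1 : ((jmul x : Module.End ℝ E) ^ (n + 1)) unit
      = jmul x (((jmul x : Module.End ℝ E) ^ n) unit) := by rw [pow_succ']; rfl
    have e2 : ((jmul x : Module.End ℝ E) ^ (n + 2)) unit
      = jmul (jmul x (((jmul x : Module.End ℝ E) ^ n) unit)) x := by
      rw [pow_succ', jmul_comm _ x, ← e1]; rfl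
    rw [e1] at h1
    -- Multiplication by x^(n+2) becomes a polynomial in the multiplications by x², x^(n+1), x^n and
    -- x, all of which commute with that by x.
    rw [e2, jmul_triple_end, jmul_comm (((jmul x : Module.End ℝ E) ^ n) unit) x]
    have hx : Commute (jmul x : Module.End ℝ E) (jmul x) := Commute.refl _
    exact (((((h2.mul_left h0).add_left (h1.mul_left hx)).add_left (h1.mul_left hx)).sub_left
      ((hx.mul_left hx).mul_left h0)).sub_left ((h0.mul_left hx).mul_left hx))

theorem commute_jmul_aeval (x : E) (f g : ℝ[X]) :
    Commute (jmul ((aeval (jmul x : Module.End ℝ E) f) unit) : Module.End ℝ E)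
      (aeval (jmul x : Module.End ℝ E) g) := by
  have h : Commute (jmul ((aeval (jmul x : Module.End ℝ E) f) unit) : Module.End ℝ E) (jmul x) := by
    induction f using Polynomial.induction_on' with
    | add p q hp hq => simpa using hp.add_left hq
    | monomial n a =>
      simpa [aeval_monomial, Algebra.algebraMap_eq_smul_one] using
        (commute_jmul_pow x n).smul_left a
  induction g using Polynomial.induction_on' with
  | add p q hp hq => simpa using hp.add_right hq
  | monomial n a =>
    simpa [aeval_monomial, Algebra.algebraMap_eq_smul_one] using (h.pow_right n).smul_right a

/-- Power associativity: with f(x) read as f(L) applied to `unit`, L being multiplication by `x`,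
polynomials in `x` multiply as in ℝ[X]. -/
theorem jmul_aeval_aeval (x : E) (f g : ℝ[X]) :
    jmul ((aeval (jmul x : Module.End ℝ E) f) unit) ((aeval (jmul x : Module.End ℝ E) g) unit) =
      aeval (jmul x : Module.End ℝ E) (f * g) unit := by
  have h := LinearMap.congr_fun (commute_jmul_aeval x f g) unit
  simp only [Module.End.mul_apply, jmul_unit] at h
  rw [h, mul_comm, map_mul, Module.End.mul_apply]

theorem isSymmetric_jmul (x : E) : (jmul x : Module.End ℝ E).IsSymmetric :=
  fun y z => inner_jmul x y z

/-- A decomposition of `x` along a complete system of `k` nonzero orthogonal idempotents. -/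
structure IsIdemDecomposition {ι : Type*} [Fintype ι] (x : E) (lam : ι → ℝ) (c : ι → E) :
    Prop where
  ne_zero : ∀ i, c i ≠ 0
  idem : ∀ i, IsIdem (c i)
  orthogonal : ∀ i j, i ≠ j → jmul (c i) (c j) = 0
  sum_eq : ∑ i, c i = unit
  eq_sum : x = ∑ i, lam i • c i

theorem aeval_congr {V : Type*} [NormedAddCommGroup V] [InnerProductSpace ℝ V]
    [FiniteDimensional ℝ V] {T : Module.End ℝ V} (hT : T.IsSymmetric) {f g : ℝ[X]}
    (h : ∀ t, T.HasEigenvalue t → f.eval t = g.eval t) : aeval T f = aeval T g := by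
  refine (hT.eigenvectorBasis rfl).toBasis.ext fun i => ?_
  rw [OrthonormalBasis.coe_toBasis,
    Module.End.aeval_apply_of_hasEigenvector (hT.hasEigenvector_eigenvectorBasis rfl i),
    Module.End.aeval_apply_of_hasEigenvector (hT.hasEigenvector_eigenvectorBasis rfl i),
    h _ (hT.hasEigenvalue_eigenvalues rfl i)]

/-- The idempotents are the values at `x` of the Lagrange basis polynomials for the eigenvalues of
multiplication by `x`; identities between polynomials in this symmetric operator need only be
checked at its eigenvalues. -/
theorem exists_finite_idemDecomposition [FiniteDimensional ℝ E] (x : E) :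
    ∃ (ι : Type) (_ : Fintype ι) (lam : ι → ℝ) (c : ι → E), IsIdemDecomposition x lam c := by
  classical
  set T : Module.End ℝ E := jmul x with hTdef
  have hT : T.IsSymmetric := isSymmetric_jmul x
  have hfin : {t | T.HasEigenvalue t}.Finite := Module.End.finite_hasEigenvalue T
  set s : Finset ℝ := hfin.toFinset with hs
  have hmem : ∀ t, t ∈ s ↔ T.HasEigenvalue t := fun t => by simp [hs]
  set b : ℝ → ℝ[X] := Lagrange.basis s id with hb
  have hself : ∀ t ∈ s, (b t).eval t = 1 := fun t ht =>
    Lagrange.eval_basis_self (v := id) (Set.injOn_id _) ht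
  have hne : ∀ t u, t ≠ u → u ∈ s → (b t).eval u = 0 := fun t u htu hu =>
    Lagrange.eval_basis_of_ne (v := id) htu hu
  set f : ℝ → E := fun t => aeval T (b t) unit with hf
  have hsum : ∀ lam : ℝ → ℝ, ∀ g : ℝ[X], (∀ t ∈ s, g.eval t = lam t) →
      aeval T g unit = ∑ t ∈ s, lam t • f t := by
    intro lam g hg
    have : aeval T g = aeval T (∑ t ∈ s, C (lam t) * b t) := by
      refine aeval_congr hT fun u hu => ?_
      have hu' := (hmem u).2 hu
      rw [hg u hu', eval_finsetSum, Finset.sum_eq_single u]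
      · simp [hself u hu']
      · intro t _ htu
        simp [hne t u htu hu']
      · exact fun h => absurd hu' h
    rw [this]
    simp [hf, LinearMap.sum_apply, Algebra.algebraMap_eq_smul_one]
  -- An eigenvalue of multiplication by `x`, such as the mean of two eigenvalues of `x`, may give
  -- the idempotent zero; these are discarded.
  have hdrop : ∀ lam : ℝ → ℝ, ∑ t ∈ s, lam t • f t =
      ∑ t : {t // t ∈ s.filter fun t => f t ≠ 0}, lam t • f t := by
    intro lam
    rw [Finset.sum_coe_sort (s.filter fun t => f t ≠ 0) fun t => lam t • f t,
      Finset.sum_filter_of_ne]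
    intro t _ h h0
    exact h (by rw [h0, smul_zero])
  refine ⟨{t // t ∈ s.filter fun t => f t ≠ 0}, inferInstance, fun t => t, fun t => f t, ?_, ?_, ?_,
    ?_, ?_⟩
  · exact fun t => (Finset.mem_filter.1 t.2).2
  · rintro ⟨t, ht⟩
    have ht' := (Finset.mem_filter.1 ht).1
    change jmul (f t) (f t) = f t
    rw [hf]
    dsimp only
    rw [jmul_aeval_aeval]
    refine LinearMap.congr_fun (aeval_congr hT fun u hu => ?_) _
    by_cases h : t = u
    · subst h; simp [hself t ht']
    · simp [hne t u h ((hmem u).2 hu)]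
  · rintro ⟨t, ht⟩ ⟨u, hu⟩ htu
    have htu' : t ≠ u := fun h => htu (Subtype.ext h)
    change jmul (f t) (f u) = 0
    rw [hf]
    dsimp only
    rw [jmul_aeval_aeval, aeval_congr hT (g := 0), map_zero, LinearMap.zero_apply]
    intro w hw
    have hw' := (hmem w).2 hw
    by_cases h : t = w
    · subst h; simp [hne u t htu'.symm hw']
    · simp [hne t w h hw']
  · have h1 := hsum (fun _ => 1) 1 (by simp)
    rw [hdrop] at h1
    simpa using h1.symm
  · have h1 := hsum (fun t => t) X (by simp)
    rw [hdrop] at h1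
    simpa [hTdef, jmul_unit] using h1

theorem IsIdemDecomposition.exists_fin {ι : Type*} [Fintype ι] {x : E} {lam : ι → ℝ} {c : ι → E}
    (h : IsIdemDecomposition x lam c) :
    ∃ (k : ℕ) (lam : Fin k → ℝ) (c : Fin k → E), IsIdemDecomposition x lam c := by
  let σ := (Fintype.equivFin ι).symm
  refine ⟨Fintype.card ι, lam ∘ σ, c ∘ σ, fun i => h.ne_zero _, fun i => h.idem _,
    fun i j hij => h.orthogonal _ _ (σ.injective.ne hij), ?_, ?_⟩
  · rw [← h.sum_eq]; exact σ.sum_comp c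
  · rw [h.eq_sum]; exact (σ.sum_comp fun i => lam i • c i).symm

theorem IsIdemDecomposition.le_finrank [FiniteDimensional ℝ E] {k : ℕ} {x : E} {lam : Fin k → ℝ} {c : Fin k → E}
    (h : IsIdemDecomposition x lam c) : k ≤ Module.finrank ℝ E := by
  have := (linearIndependent_of_ne_zero_of_inner_eq_zero (𝕜 := ℝ) h.ne_zero fun i j hij =>
    (h.idem j).inner_eq_zero (h.orthogonal i j hij)).fintype_card_le_finrank
  simpa using this

theorem IsIdem.jmul_eq_zero_of_add {a b : E} (ha : IsIdem a) (hb : IsIdem b)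
    (hab : IsIdem (a + b)) : jmul a b = 0 := by
  unfold IsIdem at *
  simp only [map_add, LinearMap.add_apply, ha, hb, jmul_comm b a] at hab
  linear_combination (norm := module) (1 / 2 : ℝ) • hab

theorem IsIdem.jmul_eq_zero_left {a b d : E} (ha : IsIdem a) (hb : IsIdem b) (hd : IsIdem d)
    (h : jmul (a + b) d = 0) : jmul a d = 0 := by
  have h1 := hd.inner_eq_zero h
  rw [inner_add_left] at h1
  exact ha.jmul_eq_zero hd (le_antisymm (by linarith [hb.inner_nonneg hd]) (ha.inner_nonneg hd))

theorem IsIdemDecomposition.exists_succ {k : ℕ} {x : E} {lam : Fin k → ℝ} {c : Fin k → E}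
    (h : IsIdemDecomposition x lam c) (i : Fin k) (hi : ¬ IsPrimitive (c i)) :
    ∃ (lam : Fin (k + 1) → ℝ) (c : Fin (k + 1) → E), IsIdemDecomposition x lam c := by
  classical
  have hex : ∃ a b : E, a ≠ 0 ∧ b ≠ 0 ∧ IsIdem a ∧ IsIdem b ∧ c i = a + b := by
    by_contra hcon
    exact hi ⟨h.ne_zero i, h.idem i, hcon⟩
  obtain ⟨a, b, ha0, hb0, ha, hb, hab⟩ := hex
  have hidem := h.idem i
  rw [hab] at hidem
  have horth : jmul a b = 0 := ha.jmul_eq_zero_of_add hb hidem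
  have hja : ∀ j, i ≠ j → jmul a (c j) = 0 := fun j hij =>
    ha.jmul_eq_zero_left hb (h.idem j) (hab ▸ h.orthogonal i j hij)
  have hjb : ∀ j, i ≠ j → jmul b (c j) = 0 := fun j hij =>
    hb.jmul_eq_zero_left ha (h.idem j) (by rw [add_comm]; exact hab ▸ h.orthogonal i j hij)
  have hba : ∀ j, jmul b (Function.update c i a j) = 0 := by
    intro j
    by_cases hj : i = j
    · subst hj; simp [jmul_comm b a, horth]
    · rw [Function.update_of_ne (Ne.symm hj)]; exact hjb j hj
  -- `μ = 1` will give the sum to the identity, `μ = lam` the expansion of `x`.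
  have hsum : ∀ μ : Fin k → ℝ, μ i • b + ∑ j, μ j • Function.update c i a j = ∑ j, μ j • c j := by
    intro μ
    rw [← Finset.add_sum_erase _ _ (Finset.mem_univ i),
      ← Finset.add_sum_erase _ (fun j => μ j • c j) (Finset.mem_univ i), hab,
      Function.update_self, Finset.sum_congr rfl (g := fun j => μ j • c j)]
    · module
    · intro j hj
      rw [Function.update_of_ne (Finset.ne_of_mem_erase hj)]
  refine ⟨Fin.cons (lam i) lam, Fin.cons b (Function.update c i a), ?_, ?_, ?_, ?_, ?_⟩
  · intro j
    refine Fin.cases hb0 (fun j => ?_) j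
    by_cases hj : j = i
    · subst hj; simpa using ha0
    · simpa [hj] using h.ne_zero j
  · intro j
    refine Fin.cases hb (fun j => ?_) j
    by_cases hj : j = i
    · subst hj; simpa using ha
    · simpa [hj] using h.idem j
  · intro j l hjl
    induction j using Fin.cases with
    | zero =>
      induction l using Fin.cases with
      | zero => exact absurd rfl hjl
      | succ l => simpa using hba l
    | succ j =>
      induction l using Fin.cases with
      | zero => simpa [jmul_comm _ b] using hba j
      | succ l =>
        have hjl' : j ≠ l := fun h => hjl (by rw [h])
        simp only [Fin.cons_succ]
        by_cases hj : j = i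
        · subst hj
          rw [Function.update_self, Function.update_of_ne hjl'.symm]
          exact hja l hjl'
        · rw [Function.update_of_ne hj]
          by_cases hl : l = i
          · subst hl
            rw [Function.update_self, jmul_comm]
            exact hja j (Ne.symm hj)
          · rw [Function.update_of_ne hl]
            exact h.orthogonal j l hjl'
  · rw [Fin.sum_univ_succ]
    have h1 := hsum fun _ => 1
    simp only [one_smul] at h1
    simpa [h.sum_eq] using h1
  · rw [Fin.sum_univ_succ]
    simpa [← h.eq_sum] using (hsum lam).symm

/-- The spectral theorem. -/
theorem exists_isSpectralDecomposition [FiniteDimensional ℝ E] (x : E) :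
    ∃ (k : ℕ) (lam : Fin k → ℝ) (c : Fin k → E), IsSpectralDecomposition x lam c := by
  classical
  obtain ⟨ι, _, lam, c, h⟩ := exists_finite_idemDecomposition x
  obtain ⟨k, hk⟩ := h.exists_fin
  let P : ℕ → Prop := fun k => ∃ (lam : Fin k → ℝ) (c : Fin k → E), IsIdemDecomposition x lam c
  have hle : ∀ k, P k → k ≤ Module.finrank ℝ E := fun k ⟨_, _, h⟩ => h.le_finrank
  -- A decomposition of maximal length: a non-primitive member could be split further.
  obtain ⟨lam, c, h⟩ : P (Nat.findGreatest P (Module.finrank ℝ E)) :=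
    Nat.findGreatest_spec (hle k hk) hk
  refine ⟨_, lam, c, ⟨fun i => ?_, h.orthogonal, h.sum_eq⟩, h.eq_sum⟩
  by_contra hi
  have h1 : P _ := h.exists_succ i hi
  exact absurd (Nat.le_findGreatest (hle _ h1) h1) (by omega)


end Algebra

/-! ### Primitive idempotents and the trace form of a simple algebra. -/

section Simple

variable {E : Type*} [NormedAddCommGroup E] [InnerProductSpace ℝ E] [EuclideanJordanAlgebra E]

theorem IsSpectralDecomposition.jmul_self {k : ℕ} {x : E} {lam : Fin k → ℝ} {c : Fin k → E}
    (h : IsSpectralDecomposition x lam c) : jmul x x = ∑ i, lam i ^ 2 • c i := by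
  rw [h.eq_sum, map_sum]
  refine Finset.sum_congr rfl fun i _ => ?_
  rw [map_sum, LinearMap.sum_apply, Finset.sum_eq_single i]
  · have := (h.frame.primitive i).2.1
    unfold IsIdem at this
    rw [map_smul, map_smul, LinearMap.smul_apply, this, smul_smul, sq]
  · intro j _ hj
    rw [map_smul, map_smul, LinearMap.smul_apply, h.frame.orthogonal j i hj, smul_zero,
      smul_zero]
  · simp

/-- The Peirce 1-space of a primitive idempotent is a line. -/
theorem IsPrimitive.mem_span_of_jmul_eq [FiniteDimensional ℝ E] {c y : E} (hc : IsPrimitive c)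
    (hy : jmul c y = y) : ∃ t : ℝ, y = t • c := by
  obtain ⟨k, lam, d, h⟩ := exists_isSpectralDecomposition y
  have hd : ∀ i, IsIdem (d i) := fun i => (h.frame.primitive i).2.1
  have hcu : IsIdem (unit - c) := hc.2.1.unit_sub
  -- ⟨y², unit - c⟩ = ⟨y, y - c∘y⟩ = 0 is a sum of nonnegative terms, so each `d i` with nonzero
  -- coefficient satisfies c∘d_i = d_i, and then equals `c` by primitivity.
  have h0 : ∑ i, lam i ^ 2 * inner ℝ (d i) (unit - c) = 0 := by
    have h1 : inner ℝ (jmul y y) (unit - c) = 0 := by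
      rw [inner_jmul, map_sub, jmul_unit, jmul_comm y c, hy, sub_self, inner_zero_right]
    rw [h.jmul_self, sum_inner] at h1
    simpa [inner_smul_left] using h1
  rw [Finset.sum_eq_zero_iff_of_nonneg fun i _ =>
    mul_nonneg (sq_nonneg _) ((hd i).inner_nonneg hcu)] at h0
  suffices hmem : y ∈ Submodule.span ℝ {c} by
    obtain ⟨t, ht⟩ := Submodule.mem_span_singleton.1 hmem
    exact ⟨t, ht.symm⟩
  rw [h.eq_sum]
  refine Submodule.sum_mem _ fun i hi => ?_
  rcases mul_eq_zero.1 (h0 i hi) with h1 | h1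
  · rw [pow_eq_zero_iff two_ne_zero] at h1
    simp [h1]
  · have h2 : jmul c (d i) = d i := by
      have := (hd i).jmul_eq_zero hcu h1
      rw [map_sub, jmul_unit, sub_eq_zero] at this
      rw [jmul_comm, ← this]
    have h3 : IsIdem (c - d i) := by
      have e1 := hd i
      have e2 := hc.2.1
      unfold IsIdem at *
      simp only [map_sub, LinearMap.sub_apply, jmul_comm (d i) c, e1, e2, h2]
      abel
    have h4 : c - d i = 0 := by
      by_contra h4
      exact hc.2.2 ⟨d i, c - d i, (h.frame.primitive i).1, h4, hd i, h3, by abel⟩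
    rw [← sub_eq_zero.1 h4]
    exact Submodule.smul_mem _ _ (Submodule.mem_span_singleton_self c)

/-- The projection of `d` to the line of a primitive idempotent `c`. -/
theorem IsPrimitive.inner_quadratic [FiniteDimensional ℝ E] {c d : E} (hc : IsPrimitive c)
    (hd : IsIdem d) :
    (2 * ‖jmul c d‖ ^ 2 - inner ℝ c d) * ‖c‖ ^ 2 = inner ℝ c d ^ 2 := by
  -- With L multiplication by `c`, 2L² - L is the Peirce projection onto the 1-space: 2t² - t is 0,
  -- 0, 1 at t = 0, 1/2, 1.
  obtain ⟨t, ht⟩ := hc.mem_span_of_jmul_eq (y := (2 : ℝ) • jmul c (jmul c d) - jmul c d) (by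
    rw [map_sub, map_smul, hc.2.1.peirce]; module)
  have h1 : inner ℝ c ((2 : ℝ) • jmul c (jmul c d) - jmul c d) = inner ℝ c d := by
    have e := hc.2.1
    unfold IsIdem at e
    rw [inner_sub_right, inner_smul_right, ← inner_jmul c c, e, ← inner_jmul c c, e]
    ring
  have h2 : inner ℝ ((2 : ℝ) • jmul c (jmul c d) - jmul c d) d =
      2 * ‖jmul c d‖ ^ 2 - inner ℝ c d := by
    rw [inner_sub_left, inner_smul_left, inner_jmul, ← hd.inner_eq, real_inner_self_eq_norm_sq]
    simp
  rw [ht, inner_smul_right, real_inner_self_eq_norm_sq] at h1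
  rw [ht, inner_smul_left] at h2
  simp only [conj_trivial] at h2
  rw [← h2, sq (inner ℝ c d), ← h1]
  ring

/-- In `inner_quadratic` all but the factor ‖c‖² is symmetric in `c` and `d`. -/
theorem IsPrimitive.norm_eq [FiniteDimensional ℝ E] {c d : E} (hc : IsPrimitive c)
    (hd : IsPrimitive d) (h : inner ℝ c d ≠ 0) : ‖c‖ ^ 2 = ‖d‖ ^ 2 := by
  have h1 := hc.inner_quadratic hd.2.1
  have h2 := hd.inner_quadratic hc.2.1
  rw [jmul_comm, real_inner_comm, ← h1] at h2
  refine (mul_left_cancel₀ ?_ h2).symm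
  intro h0
  rw [h0, zero_mul] at h1
  exact h (pow_eq_zero_iff two_ne_zero |>.1 h1.symm)

/-- Primitive idempotents of different norm are orthogonal, so those with the norm of `c` and the
others span complementary ideals; simplicity kills one. -/
theorem IsSimpleAlgebra.norm_eq [FiniteDimensional ℝ E] (hE : IsSimpleAlgebra E) {c d : E}
    (hc : IsPrimitive c) (hd : IsPrimitive d) : ‖d‖ ^ 2 = ‖c‖ ^ 2 := by
  set S : Set E := {a | IsPrimitive a ∧ ‖a‖ ^ 2 = ‖c‖ ^ 2} with hS
  set R : Set E := {a | IsPrimitive a ∧ ‖a‖ ^ 2 ≠ ‖c‖ ^ 2} with hR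
  have horth : ∀ a ∈ S, ∀ b ∈ R, inner ℝ a b = 0 := by
    intro a ha b hb
    by_contra h
    exact hb.2 (by rw [← ha.1.norm_eq hb.1 h, ha.2])
  have hperp : Submodule.span ℝ S ⟂ Submodule.span ℝ R :=
    Submodule.isOrtho_span.2 fun a ha b hb => horth a ha b hb
  have htop : Submodule.span ℝ S ⊔ Submodule.span ℝ R = ⊤ := by
    rw [eq_top_iff]
    intro x _
    obtain ⟨k, lam, b, h⟩ := exists_isSpectralDecomposition x
    rw [h.eq_sum]
    refine Submodule.sum_mem _ fun i _ => Submodule.smul_mem _ _ ?_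
    by_cases hi : ‖b i‖ ^ 2 = ‖c‖ ^ 2
    · exact Submodule.mem_sup_left (Submodule.subset_span ⟨h.frame.primitive i, hi⟩)
    · exact Submodule.mem_sup_right (Submodule.subset_span ⟨h.frame.primitive i, hi⟩)
  have hzero : ∀ x ∈ Submodule.span ℝ S, ∀ y ∈ Submodule.span ℝ R, jmul x y = 0 := by
    intro x hx y hy
    induction hx, hy using Submodule.span_induction₂ with
    | mem_mem a b ha hb => exact ha.1.2.1.jmul_eq_zero hb.1.2.1 (horth a ha b hb)
    | zero_left => simp
    | zero_right => simp
    | add_left _ _ _ _ _ _ h1 h2 => simp [h1, h2]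
    | add_right _ _ _ _ _ _ h1 h2 => simp [h1, h2]
    | smul_left _ _ _ _ _ h => simp [h]
    | smul_right _ _ _ _ _ h => simp [h]
  have hcompl : IsCompl (Submodule.span ℝ S) (Submodule.span ℝ R) :=
    ⟨hperp.disjoint, codisjoint_iff.2 htop⟩
  have hideal : ∀ I J : Submodule ℝ E, I ⟂ J → I ⊔ J = ⊤ →
      (∀ x ∈ I, ∀ y ∈ J, jmul x y = 0) → ∀ x ∈ I, ∀ y, jmul x y ∈ I := by
    intro I J hIJ hsup h0 x hx y
    obtain ⟨a, ha, b, hb, rfl⟩ := Submodule.mem_sup.1 (hsup ▸ Submodule.mem_top : y ∈ I ⊔ J)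
    rw [map_add, h0 x hx b hb, add_zero]
    obtain ⟨a', ha', b', hb', h⟩ :=
      Submodule.mem_sup.1 (hsup ▸ Submodule.mem_top : jmul x a ∈ I ⊔ J)
    have h1 : inner ℝ (jmul x a) b' = 0 := by
      rw [inner_jmul, h0 x hx b' hb', inner_zero_right]
    rw [← h, inner_add_left, hIJ.inner_eq ha' hb', zero_add, inner_self_eq_zero] at h1
    rwa [← h, h1, add_zero]
  rcases hE.2 _ _ (hideal _ _ hperp htop hzero)
    (hideal _ _ hperp.symm (sup_comm (Submodule.span ℝ R) _ ▸ htop)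
      fun x hx y hy => by rw [jmul_comm]; exact hzero y hy x hx) hcompl with h | h
  · have : c ∈ Submodule.span ℝ S := Submodule.subset_span ⟨hc, rfl⟩
    rw [h, Submodule.mem_bot] at this
    exact absurd this hc.1
  · by_contra hne
    have : d ∈ Submodule.span ℝ R := Submodule.subset_span ⟨hd, hne⟩
    rw [h, Submodule.mem_bot] at this
    exact absurd this hd.1

/-- In a simple algebra all primitive idempotents have the same norm. -/
theorem IsSimpleAlgebra.exists_norm_sq [FiniteDimensional ℝ E] (hE : IsSimpleAlgebra E) :
    ∃ θ : ℝ, 0 < θ ∧ ∀ c : E, IsPrimitive c → ‖c‖ ^ 2 = θ := by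
  by_cases h : ∃ c : E, IsPrimitive c
  · obtain ⟨c, hc⟩ := h
    exact ⟨‖c‖ ^ 2, by have := norm_pos_iff.2 hc.1; positivity, fun d hd => hE.norm_eq hc hd⟩
  · exact ⟨1, one_pos, fun c hc => absurd ⟨c, hc⟩ h⟩

theorem IsJordanFrame.inner_eq_coeff {k : ℕ} {c : Fin k → E} (hc : IsJordanFrame c) (a : Fin k → ℝ)
    (i : Fin k) : inner ℝ (c i) (∑ j, a j • c j) = a i * ‖c i‖ ^ 2 := by
  rw [inner_sum, Finset.sum_eq_single i]
  · rw [inner_smul_right, real_inner_self_eq_norm_sq]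
  · intro j _ hj
    rw [inner_smul_right, (hc.primitive j).2.1.inner_eq_zero (hc.orthogonal i j hj.symm), mul_zero]
  · simp

variable (E) in
/-- The trace inner product is the ambient one divided by `θ`, the common squared norm of the
primitive idempotents. -/
structure IsTraceScale (θ : ℝ) : Prop where
  pos : 0 < θ
  norm_sq : ∀ c : E, IsPrimitive c → ‖c‖ ^ 2 = θ
  trInner_eq : ∀ x y : E, trInner x y = inner ℝ x y / θ

theorem IsSimpleAlgebra.exists_isTraceScale [FiniteDimensional ℝ E] (hE : IsSimpleAlgebra E) :
    ∃ θ : ℝ, IsTraceScale E θ := by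
  obtain ⟨θ, hpos, hθ⟩ := hE.exists_norm_sq
  -- Every spectral decomposition yields the same trace, so the choice made in `trace` is harmless.
  have htr : ∀ (x : E) (t : ℝ), IsTrace x t → t = inner ℝ x unit / θ := by
    rintro x t ⟨k, lam, c, h, rfl⟩
    rw [eq_div_iff hpos.ne', h.eq_sum, sum_inner, Finset.sum_mul]
    refine Finset.sum_congr rfl fun i _ => ?_
    rw [real_inner_smul_left, (h.frame.primitive i).2.1.inner_unit, hθ _ (h.frame.primitive i)]
  refine ⟨θ, hpos, hθ, fun x y => ?_⟩
  obtain ⟨k, lam, c, h⟩ := exists_isSpectralDecomposition (jmul x y)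
  have hex : ∃ t, IsTrace (jmul x y) t := ⟨_, k, lam, c, h, rfl⟩
  rw [trInner, trace, htr _ _ (Classical.epsilon_spec hex), inner_jmul, jmul_unit, real_inner_comm]

theorem IsIdem.inner_cone_nonneg {c x : E} (hc : IsIdem c) (hx : x ∈ cone E) :
    0 ≤ inner ℝ c x := by
  obtain ⟨y, rfl⟩ := hx
  rw [real_inner_comm, inner_jmul, jmul_comm, real_inner_comm]
  exact hc.inner_jmul_nonneg y

theorem IsTraceScale.inner_le [FiniteDimensional ℝ E] {θ : ℝ} (hθ : IsTraceScale E θ) {c x : E}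
    (hc : IsPrimitive c) (hx : ∀ t, IsEigenvalue x t → t ≤ 1) : inner ℝ c x ≤ θ := by
  obtain ⟨k, lam, d, h⟩ := exists_isSpectralDecomposition x
  rw [h.eq_sum, inner_sum]
  calc ∑ i, inner ℝ c (lam i • d i) ≤ ∑ i, inner ℝ c (d i) := by
        refine Finset.sum_le_sum fun i _ => ?_
        rw [inner_smul_right]
        exact mul_le_of_le_one_left (hc.2.1.inner_nonneg (h.frame.primitive i).2.1)
          (hx _ ⟨k, lam, d, h, i, rfl⟩)
    _ = θ := by rw [← inner_sum, h.frame.sum_eq, hc.2.1.inner_unit, hθ.norm_sq c hc]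

/-- Bounds the set whose supremum is `normInf`; a real `sSup` of an unbounded set would be 0 and
carry no information. -/
theorem IsTraceScale.abs_eigenvalue_le {θ : ℝ} (hθ : IsTraceScale E θ) {x : E} {t : ℝ}
    (ht : IsEigenvalue x t) : |t| ≤ ‖x‖ / √θ := by
  obtain ⟨k, lam, c, h, i, rfl⟩ := ht
  have h1 := h.frame.inner_eq_coeff lam i
  have h2 := hθ.norm_sq _ (h.frame.primitive i)
  have h3 := abs_real_inner_le_norm (c i) x
  have h4 : ‖c i‖ = √θ := by rw [← h2, Real.sqrt_sq (norm_nonneg _)]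
  have h5 := Real.sqrt_pos.2 hθ.pos
  rw [← h.eq_sum, h4] at h1
  rw [h1, h4, abs_mul, abs_of_pos (pow_pos h5 2)] at h3
  rw [le_div_iff₀ h5]
  nlinarith

theorem IsJordanFrame.sum_mem_cone {k : ℕ} {c : Fin k → E} (hc : IsJordanFrame c) {a : Fin k → ℝ}
    (ha : ∀ i, 0 ≤ a i) : ∑ i, a i • c i ∈ cone E := by
  refine ⟨∑ i, √(a i) • c i, ?_⟩
  rw [IsSpectralDecomposition.jmul_self ⟨hc, rfl⟩]
  simp [Real.sq_sqrt (ha _)]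

end Simple

/-! ### The product algebra and the projection onto its cone. -/

section Blocks

variable {p : ℕ} {E : Fin p → Type*} [∀ l, NormedAddCommGroup (E l)]
  [∀ l, InnerProductSpace ℝ (E l)] [∀ l, EuclideanJordanAlgebra (E l)]

theorem prodInner_eq {θ : Fin p → ℝ} (hθ : ∀ l, IsTraceScale (E l) (θ l)) (x y : ∀ l, E l) :
    prodInner x y = ∑ l, inner ℝ (x l) (y l) / θ l :=
  Finset.sum_congr rfl fun l _ => (hθ l).trInner_eq _ _

theorem eigenvalue_le_one_of_normInf_le {θ : Fin p → ℝ} (hθ : ∀ l, IsTraceScale (E l) (θ l))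
    {x : ∀ l, E l} (hx : normInf x ≤ 1) (l : Fin p) {t : ℝ} (ht : IsEigenvalue (x l) t) :
    t ≤ 1 := by
  have hbdd : BddAbove {s : ℝ | ∃ l t, IsEigenvalue (x l) t ∧ s = |t|} := by
    refine ⟨∑ l, ‖x l‖ / √(θ l), ?_⟩
    rintro s ⟨l, t, ht, rfl⟩
    refine ((hθ l).abs_eigenvalue_le ht).trans ?_
    exact Finset.single_le_sum (f := fun l => ‖x l‖ / √(θ l)) (fun _ _ => by positivity)
      (Finset.mem_univ l)
  exact (le_abs_self t).trans ((le_csSup hbdd ⟨l, t, ht, rfl⟩).trans hx)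

/-- The obtuse angle criterion for the projection onto the cone. -/
theorem projCone_eq {θ : Fin p → ℝ} (hθ : ∀ l, IsTraceScale (E l) (θ l)) {x y : ∀ l, E l}
    (hy : y ∈ prodCone E)
    (h : ∀ l, ∀ z ∈ cone (E l), 0 ≤ inner ℝ (x l - y l) (y l - z)) : projCone x = y := by
  have hJ : ∀ u : ∀ l, E l, normJ u = √(∑ l, ‖u l‖ ^ 2 / θ l) := fun u => by
    simp only [normJ, prodInner_eq hθ, real_inner_self_eq_norm_sq]
  -- The extra term ‖y - z‖² gives uniqueness of the nearest point as well as optimality.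
  have hkey : ∀ z ∈ prodCone E, ∑ l, ‖(x - y) l‖ ^ 2 / θ l + ∑ l, ‖(y - z) l‖ ^ 2 / θ l ≤
      ∑ l, ‖(x - z) l‖ ^ 2 / θ l := by
    intro z hz
    rw [← Finset.sum_add_distrib]
    refine Finset.sum_le_sum fun l _ => ?_
    rw [← add_div]
    refine div_le_div_of_nonneg_right ?_ (hθ l).pos.le
    have h1 := h l (z l) (hz l)
    have h2 := norm_add_sq_real (x l - y l) (y l - z l)
    rw [sub_add_sub_cancel] at h2
    simp only [Pi.sub_apply]
    linarith
  have hnn : ∀ u : ∀ l, E l, 0 ≤ ∑ l, ‖u l‖ ^ 2 / θ l := fun u =>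
    Finset.sum_nonneg fun l _ => div_nonneg (sq_nonneg _) (hθ l).pos.le
  have hnear : IsNearestInCone x y := by
    refine ⟨hy, fun z hz => ?_⟩
    rw [hJ, hJ]
    exact Real.sqrt_le_sqrt (by linarith [hkey z hz, hnn (y - z)])
  obtain ⟨hz, hz'⟩ : IsNearestInCone x (projCone x) := Classical.epsilon_spec ⟨y, hnear⟩
  have h1 := hz' y hy
  rw [hJ, hJ, Real.sqrt_le_sqrt_iff (hnn _)] at h1
  have h2 : ∑ l, ‖(y - projCone x) l‖ ^ 2 / θ l = 0 :=
    le_antisymm (by linarith [hkey _ hz]) (hnn _)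
  rw [Finset.sum_eq_zero_iff_of_nonneg fun l _ => div_nonneg (sq_nonneg _) (hθ l).pos.le] at h2
  funext l
  have h3 := h2 l (Finset.mem_univ l)
  rw [div_eq_zero_iff, or_iff_left (hθ l).pos.ne', pow_eq_zero_iff two_ne_zero, norm_eq_zero,
    Pi.sub_apply, sub_eq_zero] at h3
  exact h3.symm

/-- The projection onto the cone takes the positive parts of the eigenvalues. -/
theorem projCone_eq_posPart {θ : Fin p → ℝ} (hθ : ∀ l, IsTraceScale (E l) (θ l)) {r : Fin p → ℕ}
    {c : ∀ l, Fin (r l) → E l} (hc : ∀ l, IsJordanFrame (c l)) (a : ∀ l, Fin (r l) → ℝ)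
    {x : ∀ l, E l} (hx : ∀ l, x l = ∑ k, a l k • c l k) :
    projCone x = fun l => ∑ k, max (a l k) 0 • c l k := by
  refine projCone_eq hθ (fun l => (hc l).sum_mem_cone fun k => le_max_right _ _) fun l z hz => ?_
  have h1 : x l - ∑ k, max (a l k) 0 • c l k = ∑ k, (a l k - max (a l k) 0) • c l k := by
    rw [hx, ← Finset.sum_sub_distrib]
    simp only [sub_smul]
  rw [h1, sum_inner]
  refine Finset.sum_nonneg fun k _ => ?_
  rw [real_inner_smul_left, inner_sub_right, (hc l).inner_eq_coeff]
  have h2 := ((hc l).primitive k).2.1.inner_cone_nonneg hz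
  rcases le_total 0 (a l k) with h | h
  · simp [h]
  · rw [max_eq_right h]
    nlinarith

theorem prodInner_prodUnit {θ : Fin p → ℝ} (hθ : ∀ l, IsTraceScale (E l) (θ l)) {r : Fin p → ℕ}
    {c : ∀ l, Fin (r l) → E l} (hc : ∀ l, IsJordanFrame (c l)) (a : ∀ l, Fin (r l) → ℝ) :
    prodInner (prodUnit E) (fun l => ∑ k, a l k • c l k) = ∑ l, ∑ k, a l k := by
  rw [prodInner_eq hθ]
  refine Finset.sum_congr rfl fun l _ => ?_
  rw [div_eq_iff (hθ l).pos.ne', inner_sum, Finset.sum_mul]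
  refine Finset.sum_congr rfl fun k _ => ?_
  rw [inner_smul_right, prodUnit, real_inner_comm, ((hc l).primitive k).2.1.inner_unit,
    (hθ l).norm_sq _ ((hc l).primitive k)]

end Blocks

/-! ### Weak duality and the minimum of `q`. -/

section Dual

variable {p : ℕ} {r : Fin p → ℕ}

theorem sum_sum_eq_add_erase (g : ∀ l, Fin (r l) → ℝ) (l : Fin p) (i : Fin (r l)) :
    ∑ j, ∑ k, g j k =
      g l i + ∑ k ∈ Finset.univ.erase i, g l k + ∑ j ∈ Finset.univ.erase l, ∑ k, g j k := by
  rw [Finset.add_sum_erase _ _ (Finset.mem_univ i),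
    Finset.add_sum_erase _ (fun j => ∑ k, g j k) (Finset.mem_univ l)]

theorem le_q (lam t : ∀ l, Fin (r l) → ℝ) (h0 : ∀ l k, 0 ≤ t l k) (h1 : ∀ l k, t l k ≤ 1)
    (hsum : ∑ l, ∑ k, lam l k * t l k = 0) (l : Fin p) (i : Fin (r l)) (α : ℝ) :
    t l i ≤ q lam l i α := by
  have hmul : ∀ s l k, s * t l k ≤ max s 0 := fun s l k =>
    (mul_le_mul_of_nonneg_right (le_max_left s 0) (h0 l k)).trans
      (mul_le_of_le_one_right (le_max_right s 0) (h1 l k))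
  have h2 : ∑ l, ∑ k, (-α * lam l k) * t l k = 0 := by
    simp only [mul_assoc, ← Finset.mul_sum, hsum, mul_zero]
  rw [sum_sum_eq_add_erase _ l i] at h2
  calc t l i = (1 - α * lam l i) * t l i + ∑ k ∈ Finset.univ.erase i, (-α * lam l k) * t l k
        + ∑ j ∈ Finset.univ.erase l, ∑ k, (-α * lam j k) * t j k := by linarith
    _ ≤ q lam l i α := by
        unfold q
        gcongr <;> apply hmul

theorem one_le_q (lam : ∀ l, Fin (r l) → ℝ) (l : Fin p) (i : Fin (r l)) {α : ℝ}
    (h : α * lam l i ≤ 0) : 1 ≤ q lam l i α := by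
  have h1 : 0 ≤ ∑ k ∈ Finset.univ.erase i, max (-α * lam l k) 0 :=
    Finset.sum_nonneg fun k _ => le_max_right _ _
  have h2 : 0 ≤ ∑ j ∈ Finset.univ.erase l, ∑ k, max (-α * lam j k) 0 :=
    Finset.sum_nonneg fun j _ => Finset.sum_nonneg fun k _ => le_max_right _ _
  have h3 := le_max_left (1 - α * lam l i) 0
  unfold q
  linarith

theorem q_zero (lam : ∀ l, Fin (r l) → ℝ) (l : Fin p) (i : Fin (r l)) : q lam l i 0 = 1 := by
  simp [q]

/-- At α = 1/λ both [1 - αλ]⁺ and [-αλ]⁺ vanish, so the exceptional term can be replaced by the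
regular one. -/
theorem q_inv (lam : ∀ l, Fin (r l) → ℝ) (l : Fin p) (i : Fin (r l)) (h : lam l i ≠ 0) :
    q lam l i (1 / lam l i) = ∑ j, ∑ k, max (-(1 / lam l i) * lam j k) 0 := by
  rw [sum_sum_eq_add_erase _ l i, q]
  simp [h]

theorem q_eq_max_add_mul (lam : ∀ l, Fin (r l) → ℝ) (l : Fin p) (i : Fin (r l)) (h : lam l i ≠ 0)
    {α : ℝ} (hα : 0 ≤ α * lam l i) :
    q lam l i α = max (1 - α * lam l i) 0 + α * lam l i * q lam l i (1 / lam l i) := by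
  have hmax : ∀ t, max (-α * t) 0 = α * lam l i * max (-(1 / lam l i) * t) 0 := by
    intro t
    rw [mul_max_of_nonneg _ _ hα, mul_zero]
    congr 1
    field_simp
  simp only [q, hmax, ← Finset.mul_sum]
  simp [h]
  ring

theorem isLeast_q (lam : ∀ l, Fin (r l) → ℝ) (l : Fin p) (i : Fin (r l)) (h : lam l i ≠ 0) :
    IsLeast (Set.range (q lam l i)) (min 1 (q lam l i (1 / lam l i))) := by
  constructor
  · rcases min_choice 1 (q lam l i (1 / lam l i)) with h1 | h1
    · exact ⟨0, by rw [h1, q_zero]⟩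
    · exact ⟨_, h1.symm⟩
  · rintro _ ⟨α, rfl⟩
    rcases le_total (α * lam l i) 0 with hα | hα
    · exact (min_le_left _ _).trans (one_le_q lam l i hα)
    · rw [q_eq_max_add_mul lam l i h hα]
      have hS : 0 ≤ q lam l i (1 / lam l i) := by
        rw [q_inv lam l i h]
        exact Finset.sum_nonneg fun j _ => Finset.sum_nonneg fun k _ => le_max_right _ _
      rcases le_total (α * lam l i) 1 with h1 | h1
      -- Here `q` dominates a convex combination of 1 and its value at 1/λ.
      · have h2 := le_max_left (1 - α * lam l i) 0
        have h3 := min_le_left 1 (q lam l i (1 / lam l i))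
        have h4 := min_le_right 1 (q lam l i (1 / lam l i))
        nlinarith [mul_le_mul_of_nonneg_left h4 hα,
          mul_le_mul_of_nonneg_left h3 (sub_nonneg.2 h1)]
      · refine (min_le_right _ _).trans ?_
        have h2 := le_max_right (1 - α * lam l i) 0
        nlinarith [mul_le_mul_of_nonneg_right h1 hS]

end Dual

/-! ### Application to feasible points. -/

section Feasible

variable {p m : ℕ} {E : Fin p → Type*} [∀ l, NormedAddCommGroup (E l)]
  [∀ l, InnerProductSpace ℝ (E l)] [∀ l, FiniteDimensional ℝ (E l)]
  [∀ l, EuclideanJordanAlgebra (E l)]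

theorem trInner_le_q {θ : Fin p → ℝ} (hθ : ∀ l, IsTraceScale (E l) (θ l))
    {A : (∀ l, E l) →ₗ[ℝ] (Fin m → ℝ)} {v : ∀ l, E l} (hv : v ∈ rangeAdjoint A) {r : Fin p → ℕ}
    {lam : ∀ l, Fin (r l) → ℝ} {c : ∀ l, Fin (r l) → E l}
    (hdec : ∀ l, IsSpectralDecomposition (v l) (lam l) (c l)) {x : ∀ l, E l}
    (hx : x ∈ feasible A) (l : Fin p) (i : Fin (r l)) (α : ℝ) :
    trInner (c l i) (x l) ≤ q lam l i α := by
  obtain ⟨hint, hA, hnorm⟩ := hx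
  refine le_q lam (fun l i => trInner (c l i) (x l)) (fun l k => ?_) (fun l k => ?_) ?_ l i α
  · rw [(hθ l).trInner_eq]
    exact div_nonneg
      (((hdec l).frame.primitive k).2.1.inner_cone_nonneg (interior_subset hint l)) (hθ l).pos.le
  · rw [(hθ l).trInner_eq, div_le_one (hθ l).pos]
    exact (hθ l).inner_le ((hdec l).frame.primitive k) fun t ht =>
      eigenvalue_le_one_of_normInf_le hθ hnorm l ht
  -- The weighted sum is ⟨x, v⟩ = ⟨A x, w⟩ = 0.
  · obtain ⟨w, hw⟩ := hv
    have h1 := hw x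
    rw [hA, zero_dotProduct, prodInner_eq hθ] at h1
    rw [h1]
    refine Finset.sum_congr rfl fun l _ => ?_
    rw [(hdec l).eq_sum, inner_sum, Finset.sum_div]
    refine Finset.sum_congr rfl fun k _ => ?_
    rw [(hθ l).trInner_eq, inner_smul_right, real_inner_comm, mul_div_assoc]

end Feasible

end EJA

theorem mainTheorem1 {p m : ℕ} (E : Fin p → Type*)
    [∀ l, NormedAddCommGroup (E l)] [∀ l, InnerProductSpace ℝ (E l)]
    [∀ l, FiniteDimensional ℝ (E l)] [∀ l, EuclideanJordanAlgebra (E l)]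
    (hE : ∀ l, EJA.IsSimpleAlgebra (E l))
    (A : (∀ l, E l) →ₗ[ℝ] (Fin m → ℝ))
    (v : ∀ l, E l) (hv : v ∈ EJA.rangeAdjoint A)
    (r : Fin p → ℕ) (lam : ∀ l, Fin (r l) → ℝ) (c : ∀ l, Fin (r l) → E l)
    (hdec : ∀ l, EJA.IsSpectralDecomposition (v l) (lam l) (c l))
    (l : Fin p) (i : Fin (r l)) :
    ∃ μ : ℝ, IsLeast (Set.range (EJA.q lam l i)) μ ∧
      (∀ x ∈ EJA.feasible A, EJA.trInner (c l i) (x l) ≤ μ) ∧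
      (lam l i ≠ 0 →
        μ = min 1 (EJA.prodInner (EJA.prodUnit E) (EJA.projCone (-((1 / lam l i) • v))))) ∧
      (lam l i = 0 → μ = 1) := by
  choose θ hθ using fun l => (hE l).exists_isTraceScale
  have hle : ∀ μ, IsLeast (Set.range (EJA.q lam l i)) μ →
      ∀ x ∈ EJA.feasible A, EJA.trInner (c l i) (x l) ≤ μ := by
    rintro _ ⟨⟨α, rfl⟩, _⟩ x hx
    exact EJA.trInner_le_q hθ hv hdec hx l i α
  by_cases h : lam l i = 0
  · have hleast : IsLeast (Set.range (EJA.q lam l i)) 1 := by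
      refine ⟨⟨0, EJA.q_zero lam l i⟩, ?_⟩
      rintro _ ⟨α, rfl⟩
      exact EJA.one_le_q lam l i (by rw [h, mul_zero])
    exact ⟨1, hleast, hle 1 hleast, fun h' => absurd h h', fun _ => rfl⟩
  · refine ⟨_, EJA.isLeast_q lam l i h, hle _ (EJA.isLeast_q lam l i h), fun _ => ?_,
      fun h' => absurd h' h⟩
    rw [EJA.projCone_eq_posPart hθ (fun l => (hdec l).frame)
      (fun j k => -(1 / lam l i) * lam j k), EJA.prodInner_prodUnit hθ fun l => (hdec l).frame,
      EJA.q_inv lam l i h]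
    intro j
    rw [Pi.neg_apply, Pi.smul_apply]
    conv_lhs => rw [(hdec j).eq_sum]
    rw [Finset.smul_sum, ← Finset.sum_neg_distrib]
    simp only [smul_smul, neg_mul, neg_smul]
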